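/- Call a topological group \emph{linear} if its open subgroups form a base of neighborhoods of the identity, and \emph{extremally disconnected} if the closure of every open subset is open. All groups are Hausdorff. A cardinal $\kappa$ is \emph{Ulam measurable} if a set of cardinality $\kappa$ carries a nonprincipal ultrafilter closed under countable intersections. A group is \emph{Boolean} if all its nonidentity elements have order $2$. Suppose that there exists a nondiscrete extremally disconnected linear Hausdorff topological group whose cardinality is not Ulam measurable. Then there exists a nondiscrete extremally disconnected Boolean linear Hausdorff topological group $H$ that admits a continuous group isomorphism onto a subgroup of $\mathbb Z_2^{\omega}$, where $\mathbb Z_2=\mathbb Z/2\mathbb Z$ is discrete and $\mathbb Z_2^\omega$ carries the product topology (the subgroup has the subspace topology; the inverse isomorphism need not be continuous). In particular, $|H|\le 2^{\omega}$. -/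

import Mathlib

universe u

/-- A cardinal `κ` is Ulam measurable if a set of cardinality `κ` carries a nonprincipal
ultrafilter that is closed under countable intersections. -/
def UlamMeasurable (κ : Cardinal.{u}) : Prop :=
  ∃ α : Type u, Cardinal.mk α = κ ∧
    ∃ F : Ultrafilter α, CountableInterFilter (F : Filter α) ∧ ∀ a : α, F ≠ pure a

/-- A group, written additively, is Boolean if all its nonzero elements are of order `2`. -/
def IsBooleanAddGroup (H : Type*) [AddGroup H] : Prop :=
  ∀ x : H, x ≠ 0 → addOrderOf x = 2

/-!
The group `G` is first replaced by an open Boolean subgroup: inversion is an involution of an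
extremally disconnected space, so its fixed points form an open set
(`isOpen_fixedPoints_of_involutive`).

If every countable intersection of open subgroups were open, then `0` would be a nonisolated P-point
of an extremally disconnected space, and the cardinality of the group would be Ulam measurable
(`ulamMeasurable_of_iInter_mem_nhds`). So there is a decreasing sequence of open subgroups `H m`
with nonopen intersection `N`. Open quotients inherit extremal disconnectedness, so modulo `N`
everything is as required, except that the discrete quotients by the `H m` may be too large for
countably many characters to separate their points.

This is remedied by passing to an open subgroup `W` whose image in each of these quotients is
countable. The combinatorial reason is that Hindman's theorem has no uncountable analogue: in a
vector space over `ZMod 2` with a fixed basis, colour a nonzero vector by the parity of the integer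
part of the binary logarithm of the size of its support. By a sunflower argument no uncountable
subgroup is monochromatic off `0` (`countable_of_log_card_support_mod_two`). Applied to the first
quotient in which a point does not vanish, this colouring divides the complement of `N` into two
disjoint open sets. By extremal disconnectedness their closures do not both contain `0`, so some open
subgroup `W` avoids one of the two (`exists_openAddSubgroup_countable_image`). The countably many
coordinates that occur on `W` define a continuous homomorphism from `W` to `ℕ → ZMod 2` whose kernel
is `N ∩ W`, and `H` is its range with the quotient topology of `W`.
-/

open Set Topology

/-! ### Extremally disconnected spaces -/

/-- If `U` is maximal among the open sets disjoint from their image under the involution `f`, then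
the points that `f` moves lie in `closure U ∪ closure (f ⁻¹' U)`. These two closures are disjoint by
extremal disconnectedness, and `f` exchanges them, so they contain no fixed point. -/
theorem isOpen_fixedPoints_of_involutive {X : Type*} [TopologicalSpace X] [T2Space X]
    [ExtremallyDisconnected X] {f : X → X} (hf : Continuous f) (hi : Function.Involutive f) :
    IsOpen {x | f x = x} := by
  obtain ⟨U, hU⟩ := zorn_subset {U : Set X | IsOpen U ∧ Disjoint U (f ⁻¹' U)} (by
    intro c hc hchain
    refine ⟨⋃₀ c, ⟨isOpen_sUnion fun U hU => (hc hU).1, ?_⟩, fun s hs => subset_sUnion_of_mem hs⟩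
    rw [Set.disjoint_left]
    rintro x ⟨U, hU, hxU⟩ ⟨V, hV, hxV⟩
    rcases hchain.total hU hV with h | h
    · exact Set.disjoint_left.1 (hc hV).2 (h hxU) hxV
    · exact Set.disjoint_left.1 (hc hU).2 hxU (h hxV))
  obtain ⟨hUo, hUd⟩ := hU.prop
  have hfU : IsOpen (f ⁻¹' U) := hUo.preimage hf
  have hd : Disjoint (closure U) (closure (f ⁻¹' U)) :=
    ExtremallyDisconnected.disjoint_closure_of_disjoint_isOpen hUd hUo hfU
  have hcl : ∀ x ∈ closure U, f x ∈ closure (f ⁻¹' U) := by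
    intro x hx
    refine map_mem_closure hf hx fun y hy => ?_
    simpa [hi y] using hy
  have hcl' : ∀ x ∈ closure (f ⁻¹' U), f x ∈ closure U := by
    intro x hx
    exact map_mem_closure hf hx fun y hy => hy
  have key : {x | f x = x} = (closure U ∪ closure (f ⁻¹' U))ᶜ := by
    ext x
    simp only [mem_ofPred_eq, mem_compl_iff, mem_union]
    constructor
    · rintro hx (h | h)
      · exact Set.disjoint_left.1 hd h (hx ▸ hcl x h)
      · exact Set.disjoint_left.1 hd (hx ▸ hcl' x h) h
    · intro hx
      by_contra hne
      push Not at hx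
      obtain ⟨P, Q, hP, hQ, hxP, hxQ, hPQ⟩ := t2_separation (Ne.symm hne)
      -- `O` is a neighbourhood of `x` which is disjoint from its image and could be added to `U`
      let O := P ∩ f ⁻¹' Q ∩ (closure U ∪ closure (f ⁻¹' U))ᶜ
      have hO : IsOpen O :=
        (hP.inter (hQ.preimage hf)).inter (isClosed_closure.union isClosed_closure).isOpen_compl
      have hxO : x ∈ O := ⟨⟨hxP, hxQ⟩, by simp [hx]⟩
      have hmem : U ∪ O ∈ {U : Set X | IsOpen U ∧ Disjoint U (f ⁻¹' U)} := by
        refine ⟨hUo.union hO, ?_⟩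
        rw [Set.disjoint_left]
        rintro y (hy | hy) (hy' | hy')
        · exact Set.disjoint_left.1 hUd hy hy'
        · exact hy'.2 (Or.inr (subset_closure (by simpa [hi y] using hy)))
        · exact hy.2 (Or.inr (subset_closure hy'))
        · exact Set.disjoint_left.1 hPQ hy'.1.1 hy.1.2
      exact hx.1 (subset_closure (hU.le_of_ge hmem subset_union_left (Or.inr hxO)))
  rw [key]
  exact (isClosed_closure.union isClosed_closure).isOpen_compl

theorem IsOpenMap.extremallyDisconnected {X Y : Type*} [TopologicalSpace X] [TopologicalSpace Y]
    [ExtremallyDisconnected X] {f : X → Y} (ho : IsOpenMap f) (hf : Continuous f)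
    (hs : Function.Surjective f) : ExtremallyDisconnected Y where
  open_closure U hU := by
    rw [← image_preimage_eq (closure U) hs, ho.preimage_closure_eq_closure_preimage hf]
    exact ho _ (ExtremallyDisconnected.open_closure _ (hU.preimage hf))

theorem Topology.IsOpenEmbedding.extremallyDisconnected {X Y : Type*} [TopologicalSpace X]
    [TopologicalSpace Y] [ExtremallyDisconnected Y] {f : X → Y} (hf : IsOpenEmbedding f) :
    ExtremallyDisconnected X where
  open_closure U hU := by
    rw [hf.isInducing.closure_eq_preimage_closure_image]
    exact (ExtremallyDisconnected.open_closure _ (hf.isOpenMap _ hU)).preimage hf.continuous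

/-! ### Uncountable families of finite sets -/

/-- A weak form of the sunflower lemma: up to a common root, which cancels in the symmetric
differences, four of the sets can be taken pairwise disjoint. -/
theorem exists_disjoint_symmDiff_of_not_countable {ι : Type*} [DecidableEq ι] (s : ℕ) :
    ∀ F : Set (Finset ι), (∀ a ∈ F, a.card = s) → ¬ F.Countable →
      ∃ a ∈ F, ∃ b ∈ F, ∃ c ∈ F, ∃ d ∈ F, a ≠ b ∧ Disjoint (symmDiff a b) (symmDiff c d) ∧
        (symmDiff a b).card = (symmDiff c d).card := by
  induction s with
  | zero =>
    intro F hF hc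
    refine absurd ((Set.countable_singleton ∅).mono fun a ha => ?_) hc
    simpa using hF a ha
  | succ s ih =>
    intro F hF hc
    by_cases h : ∃ i, ¬ {a ∈ F | i ∈ a}.Countable
    · -- remove a point common to uncountably many members
      obtain ⟨i, hi⟩ := h
      have himg : ¬ ((fun a : Finset ι => a.erase i) '' {a ∈ F | i ∈ a}).Countable := by
        intro hcount
        refine hi (Set.countable_of_injective_of_countable_image ?_ hcount)
        intro a ha b hb hab
        rw [← Finset.insert_erase ha.2, ← Finset.insert_erase hb.2]
        exact congrArg (insert i) hab
      obtain ⟨_, ⟨a, ha, rfl⟩, _, ⟨b, hb, rfl⟩, _, ⟨c, hc', rfl⟩, _, ⟨d, hd, rfl⟩, h1, h2, h3⟩ :=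
        ih _ (by
          rintro _ ⟨a, ha, rfl⟩
          rw [Finset.card_erase_of_mem ha.2, hF a ha.1]
          rfl) himg
      have herase : ∀ x y : Finset ι, i ∈ x → i ∈ y →
          symmDiff (x.erase i) (y.erase i) = symmDiff x y := by
        intro x y hx hy
        ext j
        simp only [Finset.mem_symmDiff, Finset.mem_erase]
        by_cases hj : j = i
        · subst hj; simp [hx, hy]
        · simp [hj]
      rw [herase a b ha.2 hb.2, herase c d hc'.2 hd.2] at h2 h3
      exact ⟨a, ha.1, b, hb.1, c, hc'.1, d, hd.1, fun hab => h1 (by rw [hab]), h2, h3⟩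
    · -- four pairwise disjoint members can be picked greedily
      push Not at h
      have hpick : ∀ T : Finset ι, ∃ a ∈ F, Disjoint a T := by
        intro T
        by_contra hT
        push Not at hT
        refine hc ((T.countable_toSet.biUnion fun i _ => h i).mono fun a ha => ?_)
        obtain ⟨i, hia, hiT⟩ := Finset.not_disjoint_iff.1 (hT a ha)
        exact mem_biUnion (x := i) hiT ⟨ha, hia⟩
      obtain ⟨a, ha, -⟩ := hpick ∅
      obtain ⟨b, hb, hba⟩ := hpick a
      obtain ⟨c, hc', hcab⟩ := hpick (a ∪ b)
      obtain ⟨d, hd, hdabc⟩ := hpick (a ∪ b ∪ c)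
      rw [Finset.disjoint_union_right] at hcab hdabc
      rw [Finset.disjoint_union_right] at hdabc
      have hsd : ∀ x y : Finset ι, Disjoint x y → symmDiff x y = x ∪ y := fun x y hxy => by
        rw [hxy.symmDiff_eq_sup, Finset.sup_eq_union]
      refine ⟨a, ha, b, hb, c, hc', d, hd, ?_, ?_, ?_⟩
      · rintro rfl
        rw [disjoint_self] at hba
        have := hF a ha
        simp [hba] at this
      · rw [hsd _ _ hba.symm, hsd _ _ hdabc.2.symm]
        simp only [Finset.disjoint_union_left, Finset.disjoint_union_right]
        exact ⟨⟨hcab.1.symm, hcab.2.symm⟩, hdabc.1.1.symm, hdabc.1.2.symm⟩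
      · rw [hsd _ _ hba.symm, hsd _ _ hdabc.2.symm, Finset.card_union_of_disjoint hba.symm,
          Finset.card_union_of_disjoint hdabc.2.symm, hF a ha, hF b hb, hF c hc', hF d hd]

theorem support_add_zmod_two {ι : Type*} [DecidableEq ι] (u v : ι →₀ ZMod 2) :
    (u + v).support = symmDiff u.support v.support := by
  ext i
  simp only [Finsupp.mem_support_iff, Finset.mem_symmDiff, Finsupp.add_apply]
  generalize u i = a
  generalize v i = b
  revert a b
  decide

theorem support_injective_zmod_two {ι : Type*} :
    Function.Injective (Finsupp.support : (ι →₀ ZMod 2) → Finset ι) := by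
  classical
  intro u v h
  have h2 : u + v = 0 := by
    rw [← Finsupp.support_eq_empty, support_add_zmod_two, h, symmDiff_self, Finset.bot_eq_empty]
  rw [eq_neg_of_add_eq_zero_left h2]
  ext i
  simp

/-- An uncountable group of finitely supported vectors over `ZMod 2` contains two nonzero vectors
with disjoint supports of the same size. Their sum has a support twice as large, so the parity of
`Nat.log 2` of the size of the support is not constant on the nonzero vectors of the group. -/
theorem countable_of_log_card_support_mod_two {ι : Type*} (Q : AddSubgroup (ι →₀ ZMod 2)) (c : ℕ)
    (hQ : ∀ v ∈ Q, v ≠ 0 → Nat.log 2 v.support.card % 2 = c) :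
    (Q : Set (ι →₀ ZMod 2)).Countable := by
  classical
  by_contra hunc
  have hun : (Q : Set (ι →₀ ZMod 2)) = ⋃ s : ℕ, {v | v ∈ Q ∧ v.support.card = s} := by
    ext v; simp
  obtain ⟨s, hs⟩ : ∃ s : ℕ, ¬ {v | v ∈ Q ∧ v.support.card = s}.Countable := by
    by_contra! h
    exact hunc (hun ▸ countable_iUnion h)
  obtain ⟨_, ⟨a, ha, rfl⟩, _, ⟨b, hb, rfl⟩, _, ⟨c', hc', rfl⟩, _, ⟨d, hd, rfl⟩, hab, hdisj, hcard⟩ :=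
    exists_disjoint_symmDiff_of_not_countable s
      (Finsupp.support '' {v | v ∈ Q ∧ v.support.card = s})
      (by rintro _ ⟨v, hv, rfl⟩; exact hv.2)
      (fun h => hs (Set.countable_of_injective_of_countable_image
        support_injective_zmod_two.injOn h))
  rw [← support_add_zmod_two, ← support_add_zmod_two] at hdisj hcard
  have hne : (a + b).support.card ≠ 0 := by
    rw [support_add_zmod_two, Finset.card_ne_zero, Finset.nonempty_iff_ne_empty]
    simpa [← Finset.bot_eq_empty, symmDiff_eq_bot] using hab
  have h2 : (a + b + (c' + d)).support.card = (a + b).support.card * 2 := by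
    rw [support_add_zmod_two, hdisj.symmDiff_eq_sup, Finset.sup_eq_union,
      Finset.card_union_of_disjoint hdisj, ← hcard, mul_two]
  have hmem := Q.add_mem ha.1 hb.1
  have e1 := hQ _ hmem (by rintro h0; simp [h0] at hne)
  have e2 := hQ _ (Q.add_mem hmem (Q.add_mem hc'.1 hd.1)) (by
    intro h0
    rw [h0] at h2
    simp at h2
    exact hne (by simp [← h2]))
  rw [h2, Nat.log_mul_base one_lt_two hne] at e2
  omega

/-! ### Ulam measurability -/

theorem UlamMeasurable.of_injective {α β : Type u} {f : α → β} (hf : Function.Injective f)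
    (F : Ultrafilter α) (hF : CountableInterFilter (F : Filter α)) (hn : ∀ a, F ≠ pure a) :
    UlamMeasurable (Cardinal.mk β) := by
  refine ⟨β, rfl, F.map f, ?_, fun b hb => ?_⟩
  · rw [Ultrafilter.coe_map]; infer_instance
  · have hmem : f ⁻¹' {b} ∈ F := by
      rw [← Ultrafilter.mem_map, hb]
      exact Ultrafilter.mem_pure.2 rfl
    obtain ⟨a, ha⟩ := F.nonempty_of_mem hmem
    refine hn a (Ultrafilter.eq_of_le ?_)
    rw [Ultrafilter.coe_pure, Filter.le_pure_iff]
    refine Filter.mem_of_superset hmem fun x hx => hf ?_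
    exact hx.trans ha.symm

/-- The union of a maximal disjoint family of open sets whose closures miss a point `a` is dense. -/
theorem exists_pairwiseDisjoint_open_mem_closure_sUnion {X : Type*} [TopologicalSpace X] [T2Space X]
    {a : X} (ha : ¬ IsOpen {a}) :
    ∃ 𝒰 : Set (Set X), 𝒰.PairwiseDisjoint id ∧
      (∀ U ∈ 𝒰, IsOpen U ∧ U.Nonempty ∧ a ∉ closure U) ∧ a ∈ closure (⋃₀ 𝒰) := by
  obtain ⟨𝒰, hmax⟩ := zorn_subset {𝒰 : Set (Set X) | 𝒰.PairwiseDisjoint id ∧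
      ∀ U ∈ 𝒰, IsOpen U ∧ U.Nonempty ∧ a ∉ closure U} (by
    intro c hc hchain
    refine ⟨⋃₀ c, ⟨?_, ?_⟩, fun s hs => subset_sUnion_of_mem hs⟩
    · exact (pairwiseDisjoint_sUnion hchain.directedOn).2 fun s hs => (hc hs).1
    · rintro U ⟨s, hs, hU⟩
      exact (hc hs).2 U hU)
  obtain ⟨hd, ho⟩ := hmax.prop
  refine ⟨𝒰, hd, ho, ?_⟩
  by_contra hcl
  -- some point `x ≠ a` would have a neighbourhood that could be added to the family
  obtain ⟨x, hx, hxa⟩ : ∃ x ∈ (closure (⋃₀ 𝒰))ᶜ, x ≠ a := by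
    by_contra! h
    refine ha ?_
    have : (closure (⋃₀ 𝒰))ᶜ = {a} := Subset.antisymm h (by simpa using hcl)
    exact this ▸ isClosed_closure.isOpen_compl
  obtain ⟨P, Q, hP, hQ, hxP, haQ, hPQ⟩ := t2_separation hxa
  set O := P ∩ (closure (⋃₀ 𝒰))ᶜ with hO
  have hxO : x ∈ O := ⟨hxP, hx⟩
  have hOd : ∀ U ∈ 𝒰, Disjoint O U := fun U hU => by
    rw [Set.disjoint_left]
    exact fun y hy hyU => hy.2 (subset_closure ⟨U, hU, hyU⟩)
  have hmem : insert O 𝒰 ∈ {𝒰 : Set (Set X) | 𝒰.PairwiseDisjoint id ∧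
      ∀ U ∈ 𝒰, IsOpen U ∧ U.Nonempty ∧ a ∉ closure U} := by
    refine ⟨hd.insert fun U hU _ => hOd U hU, ?_⟩
    rintro U (rfl | hU)
    · refine ⟨hP.inter isClosed_closure.isOpen_compl, ⟨x, hxO⟩, fun h => ?_⟩
      exact Set.disjoint_left.1 (hPQ.closure_left hQ) (closure_mono inter_subset_left h) haQ
    · exact ho U hU
  have : O ∈ 𝒰 := hmax.le_of_ge hmem (subset_insert _ _) (mem_insert _ _)
  exact hx (subset_closure ⟨O, this, hxO⟩)

/-- An extremally disconnected space whose cardinality is not Ulam measurable has no nonisolated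
P-point. For a disjoint family `𝒰` of open sets as in
`exists_pairwiseDisjoint_open_mem_closure_sUnion`, the subfamilies whose union has `a` in its closure
form an ultrafilter on `𝒰`: disjoint open sets have disjoint closures, so exactly one of `S` and `Sᶜ`
is such a subfamily. It is nonprincipal, and it is countably complete if `a` is a P-point. -/
theorem ulamMeasurable_of_iInter_mem_nhds {X : Type u} [TopologicalSpace X] [T2Space X]
    [ExtremallyDisconnected X] {a : X} (ha : ¬ IsOpen {a})
    (hP : ∀ V : ℕ → Set X, (∀ n, V n ∈ 𝓝 a) → ⋂ n, V n ∈ 𝓝 a) :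
    UlamMeasurable (Cardinal.mk X) := by
  obtain ⟨𝒰, hd, ho, hcl⟩ := exists_pairwiseDisjoint_open_mem_closure_sUnion ha
  have hopen : ∀ S : Set 𝒰, IsOpen (⋃ U ∈ S, (U : Set X)) := fun S =>
    isOpen_biUnion fun U _ => (ho U U.2).1
  have huniv : a ∈ closure (⋃ U ∈ (univ : Set 𝒰), (U : Set X)) := by
    simpa [sUnion_eq_iUnion] using hcl
  have hsub : ∀ {S T : Set 𝒰}, S ⊆ T → a ∈ closure (⋃ U ∈ S, (U : Set X)) →
      a ∈ closure (⋃ U ∈ T, (U : Set X)) := fun h =>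
    fun h' => closure_mono (biUnion_subset_biUnion_left h) h'
  have hdisj : ∀ S T : Set 𝒰, Disjoint S T → a ∈ closure (⋃ U ∈ S, (U : Set X)) →
      a ∉ closure (⋃ U ∈ T, (U : Set X)) := by
    intro S T hST hS hT
    have hST' : Disjoint (⋃ U ∈ S, (U : Set X)) (⋃ U ∈ T, (U : Set X)) := by
      simp only [disjoint_iUnion_left, disjoint_iUnion_right]
      intro U hU V hV
      exact hd V.2 U.2 fun h => Set.disjoint_left.1 hST hV (by rwa [Subtype.ext h])
    exact Set.disjoint_left.1 (ExtremallyDisconnected.disjoint_closure_of_disjoint_isOpen hST'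
      (hopen S) (hopen T)) hS hT
  have hunion : ∀ S : ℕ → Set 𝒰, (∀ n, a ∉ closure (⋃ U ∈ S n, (U : Set X))) →
      a ∉ closure (⋃ U ∈ ⋃ n, S n, (U : Set X)) := by
    intro S hS h
    have hV := hP _ fun n => (isClosed_closure (s := ⋃ U ∈ S n, (U : Set X))).isOpen_compl.mem_nhds
      (hS n)
    obtain ⟨x, hx, hx'⟩ := mem_closure_iff_nhds.1 h _ hV
    simp only [mem_iUnion] at hx'
    obtain ⟨U, ⟨n, hn⟩, hxU⟩ := hx'
    exact mem_iInter.1 hx n (subset_closure (mem_biUnion hn hxU))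
  have hdual : ∀ S : Set 𝒰, a ∉ closure (⋃ U ∈ Sᶜ, (U : Set X)) ↔
      a ∈ closure (⋃ U ∈ S, (U : Set X)) := by
    intro S
    refine ⟨fun h => ?_, fun h => hdisj _ _ disjoint_compl_right h⟩
    rw [← union_compl_self S, biUnion_union, closure_union] at huniv
    exact huniv.resolve_right h
  have hinter : ∀ S : ℕ → Set 𝒰, (∀ n, a ∈ closure (⋃ U ∈ S n, (U : Set X))) →
      a ∈ closure (⋃ U ∈ ⋂ n, S n, (U : Set X)) := by
    intro S hS
    rw [← hdual, compl_iInter]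
    exact hunion _ fun n => (hdual _).2 (hS n)
  let F : Filter 𝒰 :=
    { sets := {S | a ∈ closure (⋃ U ∈ S, (U : Set X))}
      univ_sets := huniv
      sets_of_superset := fun h hST => hsub hST h
      inter_sets := fun {S T} hS hT => by
        have := hinter (fun n => if n = 0 then S else T) (fun n => by
          split_ifs; exacts [hS, hT])
        refine hsub (fun U hU => ?_) this
        rw [mem_iInter] at hU
        exact ⟨by simpa using hU 0, by simpa using hU 1⟩ }
  let G : Ultrafilter 𝒰 := Ultrafilter.ofComplNotMemIff F hdual
  choose r hr using fun U : 𝒰 => (ho U U.2).2.1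
  refine UlamMeasurable.of_injective (f := r) ?_ G ⟨fun 𝒮 hc hS => ?_⟩ fun U hU => ?_
  · intro U V hUV
    by_contra hne
    exact Set.disjoint_left.1 (hd U.2 V.2 fun h => hne (Subtype.ext h)) (hr U) (hUV ▸ hr V)
  · rcases 𝒮.eq_empty_or_nonempty with rfl | hne
    · simp
    · obtain ⟨f, rfl⟩ := hc.exists_eq_range hne
      rw [sInter_range]
      exact hinter f fun n => hS _ (mem_range_self n)
  · have : a ∈ closure (⋃ V ∈ ({U} : Set 𝒰), (V : Set X)) := by
      have h : ({U} : Set 𝒰) ∈ G := by rw [hU]; exact Ultrafilter.mem_pure.2 rfl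
      exact h
    rw [biUnion_singleton] at this
    exact (ho U U.2).2.2 this

/-! ### Countably many characters on an open subgroup -/

/-- Coordinates of the quotient of a Boolean group by `H`, with respect to a basis over `ZMod 2`. -/
theorem exists_addMonoidHom_finsupp_ker {A : Type u} [AddCommGroup A] (h2 : ∀ x : A, x + x = 0)
    (H : AddSubgroup A) : ∃ (ι : Type u) (φ : A →+ (ι →₀ ZMod 2)), ∀ x, φ x = 0 ↔ x ∈ H := by
  have hq : ∀ x : A ⧸ H, 2 • x = 0 := by
    intro x
    induction x using QuotientAddGroup.induction_on with
    | H x => rw [two_nsmul, ← QuotientAddGroup.mk_add, h2, QuotientAddGroup.mk_zero]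
  let _ : Module (ZMod 2) (A ⧸ H) := AddCommGroup.zmodModule hq
  let b := Module.Basis.ofVectorSpace (ZMod 2) (A ⧸ H)
  refine ⟨_, b.repr.toAddEquiv.toAddMonoidHom.comp (QuotientAddGroup.mk' H),
    fun x => ?_⟩
  simp

/-- The key step. A point `x` in `H m` but not in `H (m + 1)` is coloured by the parity of
`Nat.log 2` of the size of the support of `φ (m + 1) x`. The two colour classes are disjoint open
sets, so an open subgroup `W` avoids one of them. Then the colour is constant on the points of
`W ∩ H m` outside `H (m + 1)`, whence `φ (m + 1)` maps `W ∩ H m` onto a countable group. -/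
theorem exists_openAddSubgroup_countable_image {A : Type*} [AddCommGroup A] [TopologicalSpace A]
    [NonarchimedeanAddGroup A] [ExtremallyDisconnected A]
    {H : ℕ → OpenAddSubgroup A} (hH : Antitone H) (hH0 : H 0 = ⊤)
    {ι : ℕ → Type*} (φ : ∀ m, A →+ (ι m →₀ ZMod 2)) (hφ : ∀ m x, φ m x = 0 ↔ x ∈ H m) :
    ∃ W : OpenAddSubgroup A, ∀ m, (φ m '' (W : Set A)).Countable := by
  -- the points outside `⋂ m, H m`, coloured through their class modulo the first `H (m + 1)`
  -- to which they do not belong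
  let C : ℕ → Set A := fun c => {x | ∃ m, x ∈ H m ∧ x ∉ H (m + 1) ∧
    Nat.log 2 (φ (m + 1) x).support.card % 2 = c}
  have hCo : ∀ c, IsOpen (C c) := by
    intro c
    rw [isOpen_iff_mem_nhds]
    rintro x ⟨m, hx, hx', hc⟩
    have hn : {y | y - x ∈ H (m + 1)} ∈ 𝓝 x :=
      ((H (m + 1)).isOpen.preimage (continuous_id.sub continuous_const)).mem_nhds
        (by simp)
    filter_upwards [hn] with y hy
    have e : φ (m + 1) y = φ (m + 1) x := by
      rw [← sub_eq_zero, ← map_sub, hφ]; exact hy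
    refine ⟨m, ?_, ?_, by rwa [e]⟩
    · have := (H m).add_mem (hH (Nat.le_succ m) hy) hx
      rwa [sub_add_cancel] at this
    · rwa [← hφ, e, hφ]
  have hCd : Disjoint (C 0) (C 1) := by
    rw [Set.disjoint_left]
    rintro x ⟨m, hx, hx', hc⟩ ⟨n, hy, hy', hd⟩
    have hmn : m = n := by
      rcases lt_trichotomy m n with h | h | h
      · exact absurd (hH (Nat.succ_le_of_lt h) hy) hx'
      · exact h
      · exact absurd (hH (Nat.succ_le_of_lt h) hx) hy'
    subst hmn
    omega
  have hcl := ExtremallyDisconnected.disjoint_closure_of_disjoint_isOpen hCd (hCo 0) (hCo 1)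
  obtain ⟨c, hc2, hc⟩ : ∃ c < 2, (0 : A) ∉ closure (C c) := by
    by_cases h : (0 : A) ∈ closure (C 0)
    · exact ⟨1, by norm_num, Set.disjoint_left.1 hcl h⟩
    · exact ⟨0, by norm_num, h⟩
  obtain ⟨W, hW⟩ := NonarchimedeanAddGroup.is_nonarchimedean _
    (isClosed_closure.isOpen_compl.mem_nhds hc)
  refine ⟨W, fun m => ?_⟩
  induction m with
  | zero =>
    refine (Set.countable_singleton 0).mono ?_
    rintro _ ⟨x, -, rfl⟩
    exact (hφ 0 x).2 (hH0 ▸ OpenAddSubgroup.mem_top x)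
  | succ m ih =>
    let Q : AddSubgroup (ι (m + 1) →₀ ZMod 2) :=
      ((W : AddSubgroup A) ⊓ (H m : AddSubgroup A)).map (φ (m + 1))
    have hQ : (Q : Set (ι (m + 1) →₀ ZMod 2)).Countable := by
      refine countable_of_log_card_support_mod_two Q (1 - c) ?_
      rintro _ ⟨x, ⟨hxW, hxH⟩, rfl⟩ hne
      by_contra hcol
      refine hW hxW (subset_closure ⟨m, hxH, fun h => hne ((hφ _ _).2 h), ?_⟩)
      omega
    choose! w hwW hw using fun t (ht : t ∈ φ m '' (W : Set A)) => ht
    refine (ih.image2 hQ fun t q => φ (m + 1) (w t) + q).mono ?_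
    rintro _ ⟨x, hx, rfl⟩
    have ht : φ m x ∈ φ m '' (W : Set A) := ⟨x, hx, rfl⟩
    refine ⟨φ m x, ht, φ (m + 1) (x - w (φ m x)),
      ⟨_, ⟨W.sub_mem hx (hwW _ ht), ?_⟩, rfl⟩, by simp⟩
    exact (hφ m _).1 (by rw [map_sub, hw _ ht, sub_self])

/-- On the open subgroup `W` of `exists_openAddSubgroup_countable_image`, only countably many
coordinates of the maps `φ m` do not vanish identically; together they form `ψ`. -/
theorem exists_continuous_addMonoidHom_pi_zmod_two {A : Type*} [AddCommGroup A] [TopologicalSpace A]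
    [NonarchimedeanAddGroup A] [ExtremallyDisconnected A]
    {H : ℕ → OpenAddSubgroup A} (hH : Antitone H) (hH0 : H 0 = ⊤)
    {ι : ℕ → Type*} (φ : ∀ m, A →+ (ι m →₀ ZMod 2)) (hφ : ∀ m x, φ m x = 0 ↔ x ∈ H m) :
    ∃ (W : OpenAddSubgroup A) (ψ : A →+ (ℕ → ZMod 2)), Continuous ψ ∧
      ∀ x ∈ W, ψ x = 0 → ∀ m, x ∈ H m := by
  obtain ⟨W, hW⟩ := exists_openAddSubgroup_countable_image hH hH0 φ hφ
  -- the coordinates that occur in the image of `W`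
  let J : ∀ m, Set (ι m) := fun m => ⋃ v ∈ φ m '' (W : Set A), (v.support : Set (ι m))
  have hJ : ∀ m, Countable (J m) := fun m =>
    ((hW m).biUnion fun v _ => v.support.countable_toSet).to_subtype
  have := Encodable.ofCountable (Σ m, J m)
  let χ : (Σ m, J m) → A →+ ZMod 2 := fun i => (Finsupp.applyAddHom (i.2 : ι i.1)).comp (φ i.1)
  have hχ : ∀ i, Continuous (χ i) := by
    intro i
    refine continuous_of_continuousAt_zero _ ?_
    rw [ContinuousAt, map_zero]
    refine tendsto_nhds_of_eventually_eq ?_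
    filter_upwards [(H i.1).mem_nhds_zero] with x hx
    have h0 : φ i.1 x = 0 := (hφ _ _).2 hx
    simp [χ, h0]
  refine ⟨W, AddMonoidHom.pi fun n => ((Encodable.decode (α := Σ m, J m) n).elim 0 χ), ?_, ?_⟩
  · refine continuous_pi fun n => ?_
    cases h : Encodable.decode (α := Σ m, J m) n with
    | none => simpa [h] using continuous_const
    | some i => simpa [h] using hχ i
  · intro x hx h0 m
    rw [← hφ]
    ext j
    by_contra hj
    have hjJ : j ∈ J m := mem_biUnion (mem_image_of_mem _ hx) (Finsupp.mem_support_iff.2 hj)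
    have := congrFun h0 (Encodable.encode (⟨m, j, hjJ⟩ : Σ m, J m))
    simp [χ] at this
    exact hj this

/-! ### The range of a homomorphism with the quotient topology -/

/-- The range of an additive homomorphism `ψ`, to be equipped with the quotient topology of the
source of `ψ` and not with the subspace topology. -/
def QuotientRange {A B : Type*} [AddGroup A] [AddGroup B] (ψ : A →+ B) : Type _ := ψ.range

namespace QuotientRange

variable {A B : Type*} [AddGroup A] [AddGroup B] (ψ : A →+ B)

instance : AddGroup (QuotientRange ψ) := inferInstanceAs (AddGroup ψ.range)

/-- The surjection of `A` onto the range of `ψ`. -/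
def proj : A →+ QuotientRange ψ := ψ.rangeRestrict

/-- The identity, as a map from the range of `ψ` to the subgroup `ψ.range`. -/
def equivRange : QuotientRange ψ ≃+ ψ.range := AddEquiv.refl _

instance [TopologicalSpace A] : TopologicalSpace (QuotientRange ψ) :=
  TopologicalSpace.coinduced (proj ψ) inferInstance

theorem proj_surjective : Function.Surjective (proj ψ) := ψ.rangeRestrict_surjective

theorem proj_eq_iff {x y : A} : proj ψ x = proj ψ y ↔ ψ x = ψ y := Subtype.ext_iff

variable [TopologicalSpace A]

theorem isQuotientMap_proj : IsQuotientMap (proj ψ) := ⟨⟨rfl⟩, proj_surjective ψ⟩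

theorem continuous_equivRange [TopologicalSpace B] (hψ : Continuous ψ) :
    Continuous (equivRange ψ) :=
  (isQuotientMap_proj ψ).continuous_iff.2 (hψ.subtype_mk _)

theorem t2Space [TopologicalSpace B] [T2Space B] (hψ : Continuous ψ) : T2Space (QuotientRange ψ) :=
  T2Space.of_injective_continuous (equivRange ψ).injective (continuous_equivRange ψ hψ)

theorem isOpenQuotientMap_proj [IsTopologicalAddGroup A] : IsOpenQuotientMap (proj ψ) := by
  refine ⟨proj_surjective ψ, (isQuotientMap_proj ψ).continuous, fun U hU => ?_⟩
  rw [← (isQuotientMap_proj ψ).isOpen_preimage]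
  have : proj ψ ⁻¹' (proj ψ '' U) = ⋃ k ∈ (proj ψ).ker, (fun x => x + k) ⁻¹' U := by
    ext x
    simp only [mem_preimage, mem_image, mem_iUnion, exists_prop, AddMonoidHom.mem_ker]
    constructor
    · rintro ⟨u, hu, hux⟩
      exact ⟨-x + u, by simp [hux], by simpa using hu⟩
    · rintro ⟨k, hk, hxk⟩
      exact ⟨x + k, hxk, by simp [hk]⟩
  rw [this]
  exact isOpen_biUnion fun k _ => hU.preimage (continuous_add_const k)

theorem extremallyDisconnected [IsTopologicalAddGroup A] [ExtremallyDisconnected A] :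
    ExtremallyDisconnected (QuotientRange ψ) :=
  (isOpenQuotientMap_proj ψ).isOpenMap.extremallyDisconnected
    (isQuotientMap_proj ψ).continuous (proj_surjective ψ)

theorem nonarchimedeanAddGroup [NonarchimedeanAddGroup A] :
    NonarchimedeanAddGroup (QuotientRange ψ) where
  continuous_add := by
    have h := isOpenQuotientMap_proj ψ
    rw [← (h.prodMap h).continuous_comp_iff]
    have : (fun p : QuotientRange ψ × QuotientRange ψ => p.1 + p.2) ∘ Prod.map (proj ψ) (proj ψ) =
        proj ψ ∘ fun p : A × A => p.1 + p.2 := by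
      ext p; simp
    rw [this]
    exact h.continuous.comp continuous_add
  continuous_neg := by
    rw [(isQuotientMap_proj ψ).continuous_iff]
    have : (fun x : QuotientRange ψ => -x) ∘ proj ψ = proj ψ ∘ fun x => -x := by
      ext p; simp
    rw [this]
    exact (isQuotientMap_proj ψ).continuous.comp continuous_neg
  is_nonarchimedean U hU := by
    obtain ⟨V, hV⟩ := NonarchimedeanAddGroup.is_nonarchimedean (proj ψ ⁻¹' U)
      ((isQuotientMap_proj ψ).continuous.continuousAt.preimage_mem_nhds (by rwa [map_zero]))
    exact ⟨{ (V : AddSubgroup A).map (proj ψ) with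
      isOpen' := (isOpenQuotientMap_proj ψ).isOpenMap _ V.isOpen }, image_subset_iff.2 hV⟩

theorem isOpen_ker_of_discreteTopology [DiscreteTopology (QuotientRange ψ)] :
    IsOpen {x | ψ x = 0} := by
  have h := (isOpen_discrete ({0} : Set (QuotientRange ψ))).preimage
    (isQuotientMap_proj ψ).continuous
  convert h using 1
  ext x
  rw [mem_preimage, mem_singleton_iff, ← map_zero (proj ψ), proj_eq_iff, map_zero, mem_ofPred_eq]

end QuotientRange

/-! ### Reduction to Boolean groups -/

theorem addOrderOf_pi_zmod_two {ι : Type*} {x : ι → ZMod 2} (hx : x ≠ 0) : addOrderOf x = 2 :=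
  addOrderOf_eq_prime (by ext n; exact CharTwo.two_nsmul _) hx

@[to_additive]
theorem OpenSubgroup.nonarchimedeanGroup {G : Type*} [Group G] [TopologicalSpace G]
    [NonarchimedeanGroup G] (W : OpenSubgroup G) : NonarchimedeanGroup W where
  toIsTopologicalGroup := inferInstanceAs (IsTopologicalGroup (W : Subgroup G))
  is_nonarchimedean U hU := by
    obtain ⟨L, hL⟩ := NonarchimedeanGroup.is_nonarchimedean _
      (W.isOpen.isOpenEmbedding_subtypeVal.image_mem_nhds.2 hU)
    refine ⟨L.comap (W : Subgroup G).subtype continuous_subtype_val, fun x hx => ?_⟩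
    obtain ⟨y, hy, hyx⟩ := hL hx
    rwa [← Subtype.ext hyx]

theorem NonarchimedeanGroup.additive (G : Type*) [Group G] [TopologicalSpace G]
    [NonarchimedeanGroup G] : NonarchimedeanAddGroup (Additive G) where
  is_nonarchimedean U hU := by
    obtain ⟨L, hL⟩ := NonarchimedeanGroup.is_nonarchimedean (G := G) U hU
    exact ⟨⟨Subgroup.toAddSubgroup L, L.isOpen⟩, hL⟩

/-- The case of a Boolean group. Since the cardinality is not Ulam measurable, there is a decreasing
sequence of open subgroups whose intersection is not a neighbourhood of `0`. The group `H` is the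
quotient of an open subgroup by its intersection with all of these, realized as the range of the
homomorphism of `exists_continuous_addMonoidHom_pi_zmod_two`. -/
theorem exists_quotientRange_of_boolean {A : Type u} [AddCommGroup A] [TopologicalSpace A] [T2Space A]
    [NonarchimedeanAddGroup A] [ExtremallyDisconnected A] (h2 : ∀ x : A, x + x = 0)
    (hd : ¬ DiscreteTopology A) (hm : ¬ UlamMeasurable (Cardinal.mk A)) :
    ∃ (H : Type) (_ : AddGroup H) (_ : TopologicalSpace H),
      NonarchimedeanAddGroup H ∧ T2Space H ∧ ExtremallyDisconnected H ∧ ¬ DiscreteTopology H ∧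
        IsBooleanAddGroup H ∧
        (∃ (S : AddSubgroup (ℕ → ZMod 2)) (f : H ≃+ S), Continuous f) ∧
        Cardinal.mk H ≤ 2 ^ Cardinal.aleph0 := by
  have h0 : ¬ IsOpen ({0} : Set A) := fun h => hd (discreteTopology_of_isOpen_singleton_zero h)
  obtain ⟨V, hV, hVn⟩ : ∃ V : ℕ → Set A, (∀ n, V n ∈ 𝓝 0) ∧ ⋂ n, V n ∉ 𝓝 0 := by
    by_contra! h
    exact hm (ulamMeasurable_of_iInter_mem_nhds h0 h)
  choose K hK using fun n => NonarchimedeanAddGroup.is_nonarchimedean _ (hV n)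
  let H : ℕ → OpenAddSubgroup A := fun n => Nat.rec ⊤ (fun n L => L ⊓ K n) n
  have hHs : ∀ n, H (n + 1) = H n ⊓ K n := fun n => rfl
  have hH : Antitone H := antitone_nat_of_succ_le fun n => by rw [hHs]; exact inf_le_left
  choose ι φ hφ using fun m => exists_addMonoidHom_finsupp_ker h2 (H m).toAddSubgroup
  obtain ⟨W, ψ, hψ, hψW⟩ := exists_continuous_addMonoidHom_pi_zmod_two hH rfl φ hφ
  let ψW : W →+ (ℕ → ZMod 2) := ψ.comp (W : AddSubgroup A).subtype
  have hψc : Continuous ψW := hψ.comp continuous_subtype_val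
  have hWo : IsOpenEmbedding ((↑) : W → A) := W.isOpen.isOpenEmbedding_subtypeVal
  have : ExtremallyDisconnected W := hWo.extremallyDisconnected
  have : NonarchimedeanAddGroup W := W.nonarchimedeanAddGroup
  refine ⟨QuotientRange ψW, inferInstance, inferInstance,
    QuotientRange.nonarchimedeanAddGroup ψW, QuotientRange.t2Space ψW hψc,
    QuotientRange.extremallyDisconnected ψW, fun hdisc => hVn ?_, fun x hx => ?_,
    ⟨ψW.range, QuotientRange.equivRange ψW, QuotientRange.continuous_equivRange ψW hψc⟩, ?_⟩
  · have hker := hWo.isOpenMap _ (QuotientRange.isOpen_ker_of_discreteTopology ψW)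
    refine Filter.mem_of_superset (hker.mem_nhds ⟨0, map_zero ψW, rfl⟩) ?_
    rintro _ ⟨x, hx, rfl⟩
    rw [mem_iInter]
    intro n
    have hxn := hψW x x.2 hx (n + 1)
    rw [hHs] at hxn
    exact hK n hxn.2
  · rw [← addOrderOf_injective ((ψW.range.subtype).comp (QuotientRange.equivRange ψW).toAddMonoidHom)
      (Subtype.val_injective.comp (QuotientRange.equivRange ψW).injective)]
    exact addOrderOf_pi_zmod_two fun h => hx (Subtype.ext h)
  · refine (Cardinal.mk_le_of_injective (f := fun x => (QuotientRange.equivRange ψW x).1)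
      (Subtype.val_injective.comp (QuotientRange.equivRange ψW).injective)).trans ?_
    simp

/-- Inversion is an involution that fixes `1`, so it fixes all points of a neighbourhood of `1`. -/
theorem exists_openSubgroup_mul_self_eq_one {G : Type*} [Group G] [TopologicalSpace G]
    [NonarchimedeanGroup G] [T2Space G] [ExtremallyDisconnected G] :
    ∃ B : OpenSubgroup G, ∀ x ∈ B, x * x = 1 := by
  obtain ⟨B, hB⟩ := NonarchimedeanGroup.is_nonarchimedean {x : G | x⁻¹ = x}
    ((isOpen_fixedPoints_of_involutive continuous_inv inv_involutive).mem_nhds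
      (by simp))
  exact ⟨B, fun x hx => by
    have : x⁻¹ = x := hB hx
    exact mul_eq_one_iff_eq_inv.2 this.symm⟩

theorem mainTheorem2
    (h : ∃ (G : Type u) (_ : Group G) (_ : TopologicalSpace G),
      NonarchimedeanGroup G ∧ T2Space G ∧ ExtremallyDisconnected G ∧ ¬ DiscreteTopology G ∧
        ¬ UlamMeasurable (Cardinal.mk G)) :
    ∃ (H : Type) (_ : AddGroup H) (_ : TopologicalSpace H),
      NonarchimedeanAddGroup H ∧ T2Space H ∧ ExtremallyDisconnected H ∧ ¬ DiscreteTopology H ∧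
        IsBooleanAddGroup H ∧
        (∃ (S : AddSubgroup (ℕ → ZMod 2)) (f : H ≃+ S), Continuous f) ∧
        Cardinal.mk H ≤ 2 ^ Cardinal.aleph0 := by
  obtain ⟨G, _, _, _, _, _, hd, hm⟩ := h
  obtain ⟨B, hB⟩ := exists_openSubgroup_mul_self_eq_one (G := G)
  have hBo : IsOpenEmbedding ((↑) : B → G) := B.isOpen.isOpenEmbedding_subtypeVal
  have hBB : ∀ x : B, x * x = 1 := fun x => Subtype.ext (hB x x.2)
  have hinv : ∀ x : B, x⁻¹ = x := fun x => inv_eq_of_mul_eq_one_right (hBB x)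
  have hmul : ∀ x y : B, x * y = y * x := fun x y => by
    rw [← hinv (x * y), mul_inv_rev, hinv, hinv]
  let _ : AddCommGroup (Additive B) :=
    { (inferInstance : AddGroup (Additive B)) with
      add_comm := hmul }
  have : ExtremallyDisconnected (Additive B) := hBo.extremallyDisconnected
  have : T2Space (Additive B) := inferInstanceAs (T2Space B)
  have : NonarchimedeanGroup B := B.nonarchimedeanGroup
  have : NonarchimedeanAddGroup (Additive B) := NonarchimedeanGroup.additive B
  refine exists_quotientRange_of_boolean (A := Additive B) hBB (fun hdisc => hd ?_) fun hmB => hm ?_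
  · have h1 : IsOpen ({1} : Set B) := isOpen_discrete (α := Additive B) {0}
    have := hBo.isOpenMap _ h1
    rw [image_singleton] at this
    exact discreteTopology_of_isOpen_singleton_one this
  · obtain ⟨α, hα, F, hF, hn⟩ := hmB
    obtain ⟨e⟩ := Cardinal.eq.1 hα
    exact UlamMeasurable.of_injective (f := fun a => ((e a).toMul : G))
      (Subtype.val_injective.comp e.injective) F hF hn
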